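/- Let $k,\ell\ge 1$ be fixed integers, let $\boldsymbol\alpha=(\alpha_1,\dots,\alpha_k)$ be a fixed probability distribution with $\alpha_i>0$ for all $i\in[k]$, and let $\delta>0$ be fixed. Then there is a constant $K_0=K_0(k,\ell,\boldsymbol\alpha,\delta)$ such that the following holds for every constant $K\ge K_0$, with $p=K\log n/n$. Let $\boldsymbol\beta=(\beta_1,\dots,\beta_\ell)$ (which may depend on $n$) satisfy $\beta_j\ge\delta$ for all $j\in[\ell]$, and colour the vertices $1,\dots,n$ with colours from $[\ell]$ so that exactly $\beta_jn$ vertices have colour $j$ for each $j\in[\ell]$; the vertex colouring is fixed, not random. Let $\mathbf c_1=(c_{1,1},\dots,c_{1,n})$ be an arbitrary sequence of colours from $[k]$, and let $\mathbf c_2=(c_{2,1},\dots,c_{2,n})$ be an arbitrary sequence of colours from $[\ell]$ in which each colour $j$ appears exactly $\beta_jn$ times. Give each edge of the binomial random graph $G_{n,p}$ on $[n]$ independently a random colour from $[k]$, colour $i$ having probability $\alpha_i$. Then with high probability this coloured random graph contains a Hamilton cycle $(x_1,x_2,\dots,x_n,x_{n+1}=x_1)$ such that for every $i=1,\dots,n$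 the edge $\{x_i,x_{i+1}\}$ has colour $c_{1,i}$ and the vertex $x_i$ has colour $c_{2,i}$. That is, the probability of this event tends to $1$ as $n\to\infty$, uniformly over all such $\boldsymbol\beta$, vertex colourings, $\mathbf c_1$ and $\mathbf c_2$. -/

import Mathlib

open MeasureTheory

/-- The binomial random graph `G(n, p)` with vertex set `Fin n` together with independent edge
colours from the palette `Fin k`, each of distribution `α`. The law is carried by pairs
(graph, colouring): every unordered pair of vertices gets a colour, independently of everything
else, and only the colours of the pairs that are edges of the graph are ever looked at. -/
noncomputable def coloredRandomGraph (n : ℕ) (p : unitInterval) {k : ℕ} (α : PMF (Fin k)) :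
    Measure (SimpleGraph (Fin n) × (Sym2 (Fin n) → Fin k)) :=
  (SimpleGraph.binomialRandom (Fin n) p).prod (Measure.pi fun _ : Sym2 (Fin n) => α.toMeasure)

/-- The graph `G`, with edge colouring `c` and vertex colouring `χ`, contains a Hamilton cycle
`(x_0, x_1, …, x_{n-1}, x_n = x_0)` whose `i`-th edge `{x_i, x_{i+1}}` has colour `c₁ i` and whose
`i`-th vertex `x_i` has colour `c₂ i`, for every `i = 0, …, n - 1`. -/
def HasPatternedHamiltonCycle {n k ℓ : ℕ} (G : SimpleGraph (Fin n)) (c : Sym2 (Fin n) → Fin k)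
    (χ : Fin n → Fin ℓ) (c₁ : Fin n → Fin k) (c₂ : Fin n → Fin ℓ) : Prop :=
  ∃ (v : Fin n) (x : G.Walk v v), x.IsHamiltonianCycle ∧
    (∀ i : Fin n, c s(x.getVert (i : ℕ), x.getVert ((i : ℕ) + 1)) = c₁ i) ∧
    (∀ i : Fin n, χ (x.getVert (i : ℕ)) = c₂ i)

/-! The theorem is an instance of the spread lemma: if members of a uniformly weighted family of
sets of size at most `n` contain any given `T` with probability at most `q ^ T.card`, then a
binomial random subset of the ground set with density a large constant times `q log n` contains a
member with high probability. Here the ground set is that of (pair, colour), and the members are the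
coloured edge sets of the cycles allowed by the pattern.

Spreadness with `q = O(1/n)` holds because the admissible bijections form a coset of the group
preserving the vertex colouring, whose colour classes all have linear size. Prescribing the
positions of `u` vertices therefore costs a factor `O(1/n) ^ u`. A set of edges forming `t` paths
covers `t` more vertices than it has edges; the starts and directions of the paths can be chosen in
at most `n ^ t` times exponentially many ways, which leaves a factor `O(1/n)` per edge
(`card_filter_subset_cycleEdges_le`).

The spread lemma is proved with minimal fragments. After exposing a random `W`, what is still
missing of most members can be replaced by a set of half the size (`binExp_sum_fragment_le`,
`MissBound.step`). About `log n` halvings of cost `O(q)` each and one last round of cost `q log n`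
finish the argument (`MissBound.rounds`).

In the coloured random graph an edge has only one colour, so the elements of the ground set are not
independent. Replacing edge by edge the exclusive colour by independent colours of probability `p *
min α` can only lower the chance of a hit, since a member uses each edge once (`indep_hitEvent_le`).
-/

/-! ### Random subsets of a finite set -/

/-- The expectation of `f` at a random subset of `s` that contains each element independently with
probability `p`. -/
noncomputable def binExp {X : Type*} (s : Finset X) (p : ℝ) (f : Finset X → ℝ) : ℝ :=
  ∑ W ∈ s.powerset, p ^ W.card * (1 - p) ^ (s.card - W.card) * f W

section binExp

variable {X : Type*}

lemma binExp_mono {s : Finset X} {p : ℝ} (h0 : 0 ≤ p) (h1 : p ≤ 1) {f g : Finset X → ℝ}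
    (h : ∀ W ⊆ s, f W ≤ g W) : binExp s p f ≤ binExp s p g := by
  refine Finset.sum_le_sum fun W hW => mul_le_mul_of_nonneg_left (h W (Finset.mem_powerset.1 hW)) ?_
  have := sub_nonneg.2 h1
  positivity

lemma binExp_const (s : Finset X) (p c : ℝ) : binExp s p (fun _ => c) = c := by
  rw [binExp, ← Finset.sum_mul, Finset.sum_pow_mul_eq_add_pow]
  simp

lemma binExp_add (s : Finset X) (p : ℝ) (f g : Finset X → ℝ) :
    binExp s p (fun W => f W + g W) = binExp s p f + binExp s p g := by
  simp only [binExp, mul_add, Finset.sum_add_distrib]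

lemma binExp_sub (s : Finset X) (p : ℝ) (f g : Finset X → ℝ) :
    binExp s p (fun W => f W - g W) = binExp s p f - binExp s p g := by
  simp only [binExp, mul_sub, Finset.sum_sub_distrib]

lemma binExp_const_mul (s : Finset X) (p c : ℝ) (f : Finset X → ℝ) :
    binExp s p (fun W => c * f W) = c * binExp s p f := by
  simp only [binExp, Finset.mul_sum]
  exact Finset.sum_congr rfl fun _ _ => by ring

variable [DecidableEq X]

lemma binExp_insert {a : X} {s : Finset X} (ha : a ∉ s) (p : ℝ) (f : Finset X → ℝ) :
    binExp (insert a s) p f =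
      (1 - p) * binExp s p f + p * binExp s p (fun W => f (insert a W)) := by
  simp only [binExp, Finset.sum_powerset_insert ha, Finset.mul_sum]
  congr 1 <;> refine Finset.sum_congr rfl fun W hW => ?_
  · rw [Finset.card_insert_of_notMem ha,
      Nat.succ_sub (Finset.card_le_card (Finset.mem_powerset.1 hW)), pow_succ]
    ring
  · rw [Finset.card_insert_of_notMem ha,
      Finset.card_insert_of_notMem fun h => ha (Finset.mem_powerset.1 hW h),
      Nat.add_sub_add_right, pow_succ]
    ring

/-- The union of two independent binomial random subsets is a binomial random subset. -/
lemma binExp_union (s : Finset X) (p₁ p₂ : ℝ) (f : Finset X → ℝ) :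
    binExp s p₁ (fun W₁ => binExp s p₂ fun W₂ => f (W₁ ∪ W₂)) =
      binExp s (p₁ + p₂ - p₁ * p₂) f := by
  induction s using Finset.induction_on generalizing f with
  | empty => simp [binExp]
  | insert a s ha ih =>
    simp only [binExp_insert ha, Finset.insert_union, Finset.union_insert, Finset.insert_idem,
      binExp_add, binExp_const_mul]
    rw [ih f, ih fun W => f (insert a W)]
    ring

/-- Coupling: the denser random set is the union of the sparser one with an independent set of
density `r`, where `p' = p + r - p * r`. -/
lemma binExp_anti {s : Finset X} {p p' : ℝ} (h0 : 0 ≤ p) (h : p ≤ p') (h1 : p' ≤ 1)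
    {f : Finset X → ℝ} (hf : Antitone f) : binExp s p' f ≤ binExp s p f := by
  rcases eq_or_lt_of_le (h.trans h1) with rfl | hp
  · rw [le_antisymm h1 h]
  have hp' : 0 < 1 - p := sub_pos.2 hp
  set r := (p' - p) / (1 - p) with hr
  have hr0 : 0 ≤ r := div_nonneg (sub_nonneg.2 h) hp'.le
  have hr1 : r ≤ 1 := (div_le_one hp').2 (by linarith)
  have e : p' = p + r - p * r := by
    rw [hr]
    field_simp
    ring
  rw [e, ← binExp_union]
  refine binExp_mono h0 hp.le fun W _ => ?_
  calc binExp s r (fun W₂ => f (W ∪ W₂)) ≤ binExp s r (fun _ => f W) :=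
        binExp_mono hr0 hr1 fun W₂ _ => hf Finset.subset_union_left
    _ = f W := binExp_const ..

end binExp

/-! ### Spread families -/

section Spread

variable {Ω X : Type*} [DecidableEq X]

/-- The weighted family `(A ω)`, `ω ∈ G`, of finite sets is `q`-spread. -/
def IsSpread (w : Ω → ℝ) (q : ℝ) (G : Finset Ω) (A : Ω → Finset X) : Prop :=
  ∀ T : Finset X, ∑ ω ∈ G with T ⊆ A ω, w ω ≤ q ^ T.card

open Classical in
/-- The indicator of the event that `W` contains no member of the family. -/
noncomputable def missInd (G : Finset Ω) (A : Ω → Finset X) (W : Finset X) : ℝ :=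
  if ∃ ω ∈ G, A ω ⊆ W then 0 else 1

lemma missInd_antitone (G : Finset Ω) (A : Ω → Finset X) : Antitone (missInd G A) := by
  intro W W' h
  unfold missInd
  by_cases h1 : ∃ ω ∈ G, A ω ⊆ W'
  · rw [if_pos h1]
    split_ifs <;> norm_num
  · rw [if_neg h1, if_neg fun ⟨ω, hω, hA⟩ => h1 ⟨ω, hω, hA.trans h⟩]

lemma missInd_le_one (G : Finset Ω) (A : Ω → Finset X) (W : Finset X) : missInd G A W ≤ 1 := by
  unfold missInd
  split_ifs <;> norm_num

lemma IsSpread.sum_le_one {w : Ω → ℝ} {q : ℝ} {G : Finset Ω} {A : Ω → Finset X} (h : IsSpread w q G A) : ∑ ω ∈ G, w ω ≤ 1 := by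
  simpa using h ∅

lemma IsSpread.mono {w : Ω → ℝ} (hw : ∀ ω, 0 ≤ w ω) {q : ℝ} {G G' : Finset Ω}
    {A A' : Ω → Finset X} (h : IsSpread w q G A) (hG : G' ⊆ G) (hA : ∀ ω ∈ G', A' ω ⊆ A ω) :
    IsSpread w q G' A' := fun T =>
  (Finset.sum_le_sum_of_subset_of_nonneg (fun ω hω => by
    simp only [Finset.mem_filter] at hω ⊢
    exact ⟨hG hω.1, hω.2.trans (hA ω hω.1)⟩) fun ω _ _ => hw ω).trans (h T)

/-- Minimal fragments: for each set `W` and each member `A ω`, a smallest set of the form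
`A ω' \ W` with `A ω' ⊆ W ∪ A ω`. -/
lemma exists_min_fragment (G : Finset Ω) (A : Ω → Finset X) :
    ∃ τ : Finset X → Ω → Finset X, ∀ W, ∀ ω ∈ G, τ W ω ⊆ A ω ∧ Disjoint W (τ W ω) ∧
      (∃ ω' ∈ G, A ω' ⊆ W ∪ τ W ω) ∧
      ∀ ω' ∈ G, A ω' ⊆ W ∪ A ω → (τ W ω).card ≤ (A ω' \ W).card := by
  have key : ∀ W : Finset X, ∀ ω : Ω, ∃ T : Finset X, ω ∈ G → T ⊆ A ω ∧ Disjoint W T ∧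
      (∃ ω' ∈ G, A ω' ⊆ W ∪ T) ∧ ∀ ω' ∈ G, A ω' ⊆ W ∪ A ω → T.card ≤ (A ω' \ W).card := by
    intro W ω
    by_cases hω : ω ∈ G
    · obtain ⟨ω₀, h₀, hmin⟩ := Finset.exists_min_image (G.filter fun ω' => A ω' ⊆ W ∪ A ω)
        (fun ω' => (A ω' \ W).card) ⟨ω, by simp [hω]⟩
      rw [Finset.mem_filter] at h₀
      refine ⟨A ω₀ \ W, fun _ => ⟨?_, Finset.disjoint_sdiff, ⟨ω₀, h₀.1, ?_⟩, ?_⟩⟩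
      · exact sdiff_le_iff.2 h₀.2
      · exact sdiff_le_iff.1 le_rfl
      · exact fun ω' h1 h2 => hmin ω' (Finset.mem_filter.2 ⟨h1, h2⟩)
    · exact ⟨∅, fun h => absurd h hω⟩
  choose τ hτ using key
  exact ⟨τ, fun W ω => hτ W ω⟩

omit [DecidableEq X] in
lemma sum_pow_filter_powerset_le (R : Finset X) {l l' : ℕ} (hR : R.card ≤ l) {x : ℝ}
    (hx : 0 ≤ x) :
    ∑ T ∈ R.powerset with l' < T.card, x ^ T.card ≤
      ∑ t ∈ Finset.Ioc l' l, (l.choose t : ℝ) * x ^ t := by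
  rw [← Finset.sum_fiberwise_of_maps_to (s := R.powerset.filter fun T => l' < T.card)
    (t := Finset.Ioc l' l) (g := Finset.card)]
  · refine Finset.sum_le_sum fun t _ => ?_
    rw [Finset.sum_congr rfl (g := fun _ => x ^ t) fun T hT => by
      rw [(Finset.mem_filter.1 hT).2], Finset.sum_const, nsmul_eq_mul]
    refine mul_le_mul_of_nonneg_right ?_ (by positivity)
    norm_cast
    calc _ ≤ (R.powersetCard t).card := Finset.card_le_card fun T hT => by
          simp only [Finset.mem_filter, Finset.mem_powerset, Finset.mem_powersetCard] at hT ⊢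
          exact ⟨hT.1.1, hT.2⟩
      _ = R.card.choose t := Finset.card_powersetCard ..
      _ ≤ l.choose t := Nat.choose_le_choose t hR
  · intro T hT
    simp only [Finset.mem_filter, Finset.mem_powerset, Finset.mem_Ioc] at hT ⊢
    exact ⟨hT.2, (Finset.card_le_card hT.1).trans hR⟩

variable [Fintype X]

/-- The expected weight of the members with a large minimal fragment is small. -/
lemma binExp_sum_fragment_le {w : Ω → ℝ} (hw : ∀ ω, 0 ≤ w ω) {q p : ℝ} (hq : 0 ≤ q)
    (hp : 0 < p) (hp1 : p ≤ 1) {G : Finset Ω} {A : Ω → Finset X} {l : ℕ} (l' : ℕ)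
    (hs : IsSpread w q G A) (hA : ∀ ω ∈ G, (A ω).card ≤ l) {τ : Finset X → Ω → Finset X}
    (hτ : ∀ W, ∀ ω ∈ G, τ W ω ⊆ A ω ∧ Disjoint W (τ W ω) ∧
      (∃ ω' ∈ G, A ω' ⊆ W ∪ τ W ω) ∧
      ∀ ω' ∈ G, A ω' ⊆ W ∪ A ω → (τ W ω).card ≤ (A ω' \ W).card) :
    binExp Finset.univ p (fun W => ∑ ω ∈ G with l' < (τ W ω).card, w ω) ≤
      ∑ t ∈ Finset.Ioc l' l, (l.choose t : ℝ) * (q / p) ^ t := by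
  classical
  set N := (Finset.univ : Finset X).card with hN
  set b : Finset X → ℝ := fun W => p ^ W.card * (1 - p) ^ (N - W.card) with hb
  have h1p := sub_nonneg.2 hp1
  have hb0 : ∀ W, 0 ≤ b W := fun W => by positivity
  set U : Finset X → Finset (Finset X) := fun W =>
    (G.filter fun ω => l' < (τ W ω).card).image (τ W) with hU
  have h1 : ∀ W, ∑ ω ∈ G with l' < (τ W ω).card, w ω ≤ ∑ T ∈ U W, q ^ T.card := by
    intro W
    rw [← Finset.sum_fiberwise_of_maps_to (t := U W) (g := τ W)
      fun ω hω => Finset.mem_image_of_mem _ hω]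
    refine Finset.sum_le_sum fun T _ => (Finset.sum_le_sum_of_subset_of_nonneg ?_
      fun ω _ _ => hw ω).trans (hs T)
    intro ω hω
    simp only [Finset.mem_filter] at hω ⊢
    exact ⟨hω.1.1, hω.2 ▸ (hτ W ω hω.1.1).1⟩
  -- `R Z` is one member inside `Z`, chosen knowing `Z` only. A fragment `T` of `W` lies in `R (W ∪
  -- T)`, so given `Z = W ∪ T` there are few candidates for `T`.
  have hR : ∃ R : Finset X → Finset X, (∀ Z, (R Z).card ≤ l) ∧
      ∀ Z, (∃ ω ∈ G, A ω ⊆ Z) → ∃ ω ∈ G, A ω ⊆ Z ∧ R Z = A ω := by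
    have : ∀ Z : Finset X, ∃ R : Finset X, R.card ≤ l ∧
        ((∃ ω ∈ G, A ω ⊆ Z) → ∃ ω ∈ G, A ω ⊆ Z ∧ R = A ω) := by
      intro Z
      by_cases h : ∃ ω ∈ G, A ω ⊆ Z
      · obtain ⟨ω, h2, h3⟩ := h
        exact ⟨A ω, hA ω h2, fun _ => ⟨ω, h2, h3, rfl⟩⟩
      · exact ⟨∅, by simp, fun h' => absurd h' h⟩
    choose R hR using this
    exact ⟨R, fun Z => (hR Z).1, fun Z => (hR Z).2⟩
  obtain ⟨R, hRl, hRG⟩ := hR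
  have hTU : ∀ W, ∀ T ∈ U W, Disjoint W T ∧ T ⊆ R (W ∪ T) ∧ l' < T.card := by
    intro W T hT
    obtain ⟨ω, hω, rfl⟩ := Finset.mem_image.1 hT
    rw [Finset.mem_filter] at hω
    obtain ⟨t1, t2, t3, t4⟩ := hτ W ω hω.1
    refine ⟨t2, ?_, hω.2⟩
    obtain ⟨ω', h1, h2, h3⟩ := hRG _ t3
    rw [h3]
    have h4 : A ω' \ W ⊆ τ W ω := sdiff_le_iff.2 h2
    -- Minimality of the fragment: `A ω' \ W` competes with it and is contained in it, hence equals
    -- it.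
    have h5 := Finset.eq_of_subset_of_card_le h4
      (t4 ω' h1 (h2.trans (Finset.union_subset_union_right t1)))
    rw [← h5]
    exact Finset.sdiff_subset
  -- Passing from `W` to `W ∪ T` multiplies the probability by `(p / (1 - p)) ^ T.card`, which is at
  -- least `p ^ T.card`.
  have hbW : ∀ W T : Finset X, Disjoint W T → b W * q ^ T.card ≤ b (W ∪ T) * (q / p) ^ T.card := by
    intro W T hWT
    have hc : (W ∪ T).card = W.card + T.card := Finset.card_union_of_disjoint hWT
    have hcN : (W ∪ T).card ≤ N := Finset.card_le_card (Finset.subset_univ _)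
    have e : N - W.card = (N - (W ∪ T).card) + T.card := by omega
    simp only [hb]
    rw [e, hc, pow_add, pow_add, div_pow]
    have : (1 - p) ^ T.card ≤ 1 := pow_le_one₀ h1p (by linarith)
    have hpp : p ^ T.card ≠ 0 := by positivity
    calc _ = p ^ W.card * (1 - p) ^ (N - (W.card + T.card)) * q ^ T.card * (1 - p) ^ T.card := by
          ring
      _ ≤ p ^ W.card * (1 - p) ^ (N - (W.card + T.card)) * q ^ T.card * 1 := by gcongr
      _ = _ := by field_simp
  calc binExp Finset.univ p (fun W => ∑ ω ∈ G with l' < (τ W ω).card, w ω)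
      ≤ binExp Finset.univ p (fun W => ∑ T ∈ U W, q ^ T.card) :=
        binExp_mono hp.le hp1 fun W _ => h1 W
    _ = ∑ W : Finset X, ∑ T ∈ U W, b W * q ^ T.card := by
        simp only [binExp, Finset.powerset_univ, Finset.mul_sum, hb, hN]
    _ = ∑ x ∈ (Finset.univ : Finset (Finset X)).sigma U, b x.1 * q ^ x.2.card := by
        rw [Finset.sum_sigma]
    _ ≤ ∑ x ∈ (Finset.univ : Finset (Finset X)).sigma U,
          b (x.1 ∪ x.2) * (q / p) ^ x.2.card := by
        refine Finset.sum_le_sum fun x hx => hbW _ _ (hTU _ _ (Finset.mem_sigma.1 hx).2).1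
    _ = ∑ y ∈ ((Finset.univ : Finset (Finset X)).sigma U).image
          (fun x => (⟨x.1 ∪ x.2, x.2⟩ : (_ : Finset X) × Finset X)),
          b y.1 * (q / p) ^ y.2.card := by
        rw [Finset.sum_image]
        rintro ⟨W, T⟩ hx ⟨W', T'⟩ hx' h
        have d1 := (hTU _ _ (Finset.mem_sigma.1 hx).2).1
        have d2 := (hTU _ _ (Finset.mem_sigma.1 hx').2).1
        simp only [Sigma.mk.injEq, heq_eq_eq] at h d1 d2 ⊢
        obtain ⟨h1, rfl⟩ := h
        refine ⟨?_, rfl⟩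
        rw [← Finset.union_sdiff_cancel_right d1, h1, Finset.union_sdiff_cancel_right d2]
    _ ≤ ∑ y ∈ (Finset.univ : Finset (Finset X)).sigma
          (fun Z => (R Z).powerset.filter fun T => l' < T.card),
          b y.1 * (q / p) ^ y.2.card := by
        refine Finset.sum_le_sum_of_subset_of_nonneg ?_ fun y _ _ =>
          mul_nonneg (hb0 _) (by positivity)
        intro y hy
        obtain ⟨x, hx, rfl⟩ := Finset.mem_image.1 hy
        obtain ⟨_, d2, d3⟩ := hTU _ _ (Finset.mem_sigma.1 hx).2
        simp only [Finset.mem_sigma, Finset.mem_univ, Finset.mem_filter, Finset.mem_powerset,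
          true_and]
        exact ⟨d2, d3⟩
    _ = binExp Finset.univ p (fun Z => ∑ T ∈ (R Z).powerset with l' < T.card,
          (q / p) ^ T.card) := by
        simp only [binExp, Finset.powerset_univ, Finset.mul_sum, hb, hN, Finset.sum_sigma]
    _ ≤ binExp Finset.univ p (fun _ => ∑ t ∈ Finset.Ioc l' l, (l.choose t : ℝ) * (q / p) ^ t) :=
        binExp_mono hp.le hp1 fun Z _ => sum_pow_filter_powerset_le _ (hRl Z) (by positivity)
    _ = _ := binExp_const ..

/-- For every `q`-spread family of sets of size at most `l`, the `p`-random set contains no member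
with probability at most `ε` plus the defect of the total weight. -/
def MissBound (X : Type*) [Fintype X] [DecidableEq X] (w : Ω → ℝ) (q : ℝ) (l : ℕ) (p ε : ℝ) :
    Prop :=
  ∀ (G : Finset Ω) (A : Ω → Finset X), IsSpread w q G A → (∀ ω ∈ G, (A ω).card ≤ l) →
    binExp Finset.univ p (missInd G A) ≤ 1 - ∑ ω ∈ G, w ω + ε

lemma MissBound.zero (w : Ω → ℝ) (q : ℝ) : MissBound X w q 0 0 0 := by
  intro G A hs hA
  rcases G.eq_empty_or_nonempty with rfl | ⟨ω, hω⟩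
  · simp only [Finset.sum_empty, sub_zero, add_zero]
    calc _ ≤ binExp Finset.univ 0 (fun _ : Finset X => (1 : ℝ)) :=
          binExp_mono le_rfl zero_le_one fun W _ => missInd_le_one _ _ W
      _ = 1 := binExp_const ..
  · have h : missInd G A = fun _ => 0 := by
      funext W
      unfold missInd
      rw [if_pos ⟨ω, hω, by simp [Finset.card_eq_zero.1 (Nat.le_zero.1 (hA ω hω))]⟩]
    rw [h, binExp_const]
    linarith [hs.sum_le_one]

lemma MissBound.mono {w : Ω → ℝ} {q : ℝ} {l l' : ℕ} {p p' ε ε' : ℝ}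
    (h : MissBound X w q l p ε) (hl : l' ≤ l) (hp : 0 ≤ p) (hpp : p ≤ p') (hp' : p' ≤ 1)
    (hε : ε ≤ ε') : MissBound X w q l' p' ε' := fun G A hs hA => by
  have := h G A hs fun ω hω => (hA ω hω).trans hl
  have h2 := binExp_anti (s := Finset.univ) hp hpp hp' (missInd_antitone G A)
  linarith

/-- Two-round exposure. After the first set `W`, members with fragments larger than `l'` are
discarded and the others replaced by their fragments. These form a spread family again, as fragments
are subsets of members. The discarded weight enters through the term `1 - ∑ w` of `MissBound`, and
its expectation is the new error. -/
lemma MissBound.step {w : Ω → ℝ} (hw : ∀ ω, 0 ≤ w ω) {q : ℝ} (hq : 0 ≤ q) {l l' : ℕ}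
    {p₁ p₂ ε : ℝ} (h : MissBound X w q l' p₂ ε) (hp₁ : 0 < p₁) (hp₁1 : p₁ ≤ 1)
    (hp₂ : 0 ≤ p₂) (hp : p₁ + p₂ ≤ 1) :
    MissBound X w q l (p₁ + p₂)
      (ε + ∑ t ∈ Finset.Ioc l' l, (l.choose t : ℝ) * (q / p₁) ^ t) := by
  intro G A hs hA
  obtain ⟨τ, hτ⟩ := exists_min_fragment G A
  have hle : ∀ W ⊆ (Finset.univ : Finset X),
      binExp Finset.univ p₂ (fun W₂ => missInd G A (W ∪ W₂)) ≤
        1 - ∑ ω ∈ G, w ω + ε + ∑ ω ∈ G with l' < (τ W ω).card, w ω := by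
    intro W _
    set G' := G.filter fun ω => ¬ l' < (τ W ω).card
    have hG' : G' ⊆ G := Finset.filter_subset _ _
    have h1 := h G' (τ W) (hs.mono hw hG' fun ω hω => (hτ W ω (hG' hω)).1)
      fun ω hω => not_lt.1 (Finset.mem_filter.1 hω).2
    have h2 : ∑ ω ∈ G, w ω = ∑ ω ∈ G with l' < (τ W ω).card, w ω + ∑ ω ∈ G', w ω :=
      (Finset.sum_filter_add_sum_filter_not ..).symm
    have h3 : binExp Finset.univ p₂ (fun W₂ => missInd G A (W ∪ W₂)) ≤
        binExp Finset.univ p₂ (missInd G' (τ W)) := by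
      refine binExp_mono hp₂ (by linarith) fun W₂ _ => ?_
      unfold missInd
      by_cases hc : ∃ ω ∈ G', τ W ω ⊆ W₂
      · obtain ⟨ω, hω, hW₂⟩ := hc
        obtain ⟨ω', hω', hA'⟩ := (hτ W ω (hG' hω)).2.2.1
        rw [if_pos ⟨ω', hω', hA'.trans (Finset.union_subset_union_right hW₂)⟩]
        split_ifs <;> norm_num
      · rw [if_neg hc]
        split_ifs <;> norm_num
    linarith
  calc binExp Finset.univ (p₁ + p₂) (missInd G A)
      ≤ binExp Finset.univ (p₁ + p₂ - p₁ * p₂) (missInd G A) :=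
        binExp_anti (by nlinarith) (by nlinarith) hp (missInd_antitone G A)
    _ = binExp Finset.univ p₁ fun W =>
          binExp Finset.univ p₂ (fun W₂ => missInd G A (W ∪ W₂)) := (binExp_union ..).symm
    _ ≤ binExp Finset.univ p₁ fun W =>
          1 - ∑ ω ∈ G, w ω + ε + ∑ ω ∈ G with l' < (τ W ω).card, w ω :=
        binExp_mono hp₁.le hp₁1 hle
    _ = 1 - ∑ ω ∈ G, w ω + ε +
          binExp Finset.univ p₁ fun W => ∑ ω ∈ G with l' < (τ W ω).card, w ω := by
        rw [binExp_add _ _ (fun _ => 1 - ∑ ω ∈ G, w ω + ε), binExp_const]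
    _ ≤ 1 - ∑ ω ∈ G, w ω +
          (ε + ∑ t ∈ Finset.Ioc l' l, (l.choose t : ℝ) * (q / p₁) ^ t) := by
        linarith [binExp_sum_fragment_le hw hq hp₁ hp₁1 l' hs hA hτ]

lemma sum_choose_mul_pow_le {x : ℝ} (hx : 0 ≤ x) (hx1 : x ≤ 1) (l l' : ℕ) :
    ∑ t ∈ Finset.Ioc l' l, (l.choose t : ℝ) * x ^ t ≤ 2 ^ l * x ^ (l' + 1) := by
  calc ∑ t ∈ Finset.Ioc l' l, (l.choose t : ℝ) * x ^ t
      ≤ ∑ t ∈ Finset.Ioc l' l, (l.choose t : ℝ) * x ^ (l' + 1) := by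
        refine Finset.sum_le_sum fun t ht => mul_le_mul_of_nonneg_left ?_ (by positivity)
        exact pow_le_pow_of_le_one hx hx1 (Finset.mem_Ioc.1 ht).1
    _ ≤ ∑ t ∈ Finset.range (l + 1), (l.choose t : ℝ) * x ^ (l' + 1) := by
        refine Finset.sum_le_sum_of_subset_of_nonneg ?_ fun _ _ _ => by positivity
        intro t ht
        simp only [Finset.mem_Ioc, Finset.mem_range] at ht ⊢
        omega
    _ = _ := by
        rw [← Finset.sum_mul]
        congr 1
        exact_mod_cast Nat.sum_range_choose l

/-- Halving rounds followed by one final round. -/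
lemma MissBound.rounds {w : Ω → ℝ} (hw : ∀ ω, 0 ≤ w ω) {q : ℝ} (hq : 0 < q) {B : ℝ} (hB : 1 ≤ B)
    {M : ℕ} (hM : 1 ≤ M) (j : ℕ) (hp : (B + 8 * j) * q ≤ 1) :
    MissBound X w q (2 ^ j * M) ((B + 8 * j) * q)
      (2 ^ M / B + 2 * (1 / 2) ^ M * (1 - (1 / 2) ^ j)) := by
  induction j with
  | zero =>
    simp only [Nat.cast_zero, mul_zero, add_zero] at hp
    have hBq : 0 < B * q := by positivity
    have h := (MissBound.zero (X := X) w q).step (l := M) hw hq.le hBq hp le_rfl (by simpa using hp)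
    have e : q / (B * q) = 1 / B := by field_simp
    refine h.mono (by simp) (by simpa using hBq.le) (by simp) (by simpa using hp) ?_
    rw [e]
    have := sum_choose_mul_pow_le (x := 1 / B) (by positivity)
      ((div_le_one (by positivity)).2 hB) M 0
    simp only [zero_add, pow_one, pow_zero, sub_self, mul_zero, add_zero] at this ⊢
    calc _ ≤ _ := this
      _ = _ := by ring
  | succ j ih =>
    have hj : (0 : ℝ) ≤ j := j.cast_nonneg
    push_cast at hp ⊢
    have e1 : (B + 8 * (j + 1)) * q = 8 * q + (B + 8 * j) * q := by ring
    have hp2 : 0 ≤ (B + 8 * j) * q := by positivity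
    have hp1 : 8 * q ≤ 1 := by linarith
    have h := (ih (by linarith)).step (l := 2 ^ (j + 1) * M) hw hq.le
      (by positivity : 0 < 8 * q) hp1 hp2 (by linarith)
    rw [← e1] at h
    refine h.mono le_rfl (by positivity) le_rfl hp ?_
    have e : q / (8 * q) = 1 / 8 := by field_simp
    rw [e]
    have h1 := sum_choose_mul_pow_le (x := 1 / 8) (by norm_num) (by norm_num)
      (2 ^ (j + 1) * M) (2 ^ j * M)
    -- With `L = 2 ^ j * M`, the round from `2 * L` to `L` fails with weight at most `4 ^ L / 8 ^
    -- L`. Since `L ≥ M + j`, these errors sum geometrically.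
    have h2 : (2 : ℝ) ^ (2 ^ (j + 1) * M) * (1 / 8) ^ (2 ^ j * M + 1) ≤ (1 / 2) ^ (2 ^ j * M) := by
      rw [show 2 ^ (j + 1) * M = 2 * (2 ^ j * M) by ring, pow_mul, pow_succ (1 / 8 : ℝ),
        ← mul_assoc, ← mul_pow]
      norm_num
    have h3 : ((1 : ℝ) / 2) ^ (2 ^ j * M) ≤ (1 / 2) ^ (M + j) := by
      refine pow_le_pow_of_le_one (by norm_num) (by norm_num) ?_
      have : j + 1 ≤ 2 ^ j := Nat.lt_two_pow_self
      nlinarith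
    have h4 : ((1 : ℝ) / 2) ^ (M + j) =
        2 * (1 / 2) ^ M * (1 - (1 / 2) ^ (j + 1)) - 2 * (1 / 2) ^ M * (1 - (1 / 2) ^ j) := by
      rw [pow_add, pow_succ]
      ring
    linarith

end Spread

/-! ### Colour preserving permutations -/

section Perm

/-- For `r ≤ v` this is Stirling's bound `m ^ m / m! ≤ e ^ m` with `m = r + v ≤ 2 * v` and `e ^ 2 ≤
9`. For `v < r` each of the `v` extra factors of `(r + v)!` exceeds `r`. -/
lemma factorial_mul_div_nine_pow_le (r v : ℕ) :
    (r.factorial : ℝ) * (((r + v : ℕ) : ℝ) / 9) ^ v ≤ ((r + v).factorial : ℝ) := by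
  rcases le_or_gt r v with h | h
  · have h1 : ((r + v : ℕ) : ℝ) ^ (r + v) / ((r + v).factorial : ℝ) ≤ Real.exp ((r + v : ℕ) : ℝ) :=
      Real.pow_div_factorial_le_exp _ (Nat.cast_nonneg _) _
    have h2 : Real.exp ((r + v : ℕ) : ℝ) ≤ 9 ^ v := by
      have h3 : Real.exp 1 ≤ 3 := Real.exp_one_lt_three.le
      calc Real.exp ((r + v : ℕ) : ℝ) ≤ Real.exp ((2 * v : ℕ) : ℝ) :=
            Real.exp_le_exp.2 (by exact_mod_cast (by omega : r + v ≤ 2 * v))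
        _ = (Real.exp 1 ^ 2) ^ v := by rw [← Real.exp_one_pow, pow_mul]
        _ ≤ 9 ^ v := by
          refine pow_le_pow_left₀ (by positivity) ?_ _
          nlinarith [Real.exp_pos 1]
    have h4 : (r.factorial : ℝ) ≤ ((r + v : ℕ) : ℝ) ^ r := by
      exact_mod_cast (Nat.factorial_le_pow r).trans (Nat.pow_le_pow_left (by omega) r)
    have h5 := h1.trans h2
    rw [div_le_iff₀ (by positivity)] at h5
    rw [div_pow, ← mul_div_assoc, div_le_iff₀ (by positivity)]
    calc _ ≤ ((r + v : ℕ) : ℝ) ^ r * ((r + v : ℕ) : ℝ) ^ v := by gcongr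
      _ = ((r + v : ℕ) : ℝ) ^ (r + v) := (pow_add ..).symm
      _ ≤ _ := by linarith
  · have h1 : (r.factorial : ℝ) * ((r + 1 : ℕ) : ℝ) ^ v ≤ ((r + v).factorial : ℝ) := by
      exact_mod_cast Nat.factorial_mul_pow_le_factorial
    refine le_trans ?_ h1
    have h2 : ((v : ℕ) : ℝ) ≤ r := by exact_mod_cast h.le
    have : (0 : ℝ) ≤ r := r.cast_nonneg
    gcongr
    push_cast
    linarith

variable {V : Type*} [Fintype V] [DecidableEq V] {ℓ : ℕ}

/-- Among the permutations preserving a colouring with large colour classes, few fix all elements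
of `U`. -/
lemma card_perm_fixing_mul_le (χ : V → Fin ℓ) {d : ℝ} (hd : 0 ≤ d)
    (hχ : ∀ j, d ≤ ((Finset.univ.filter fun v => χ v = j).card : ℝ)) (U : Finset V) :
    (Fintype.card {g : Equiv.Perm V // (∀ v, χ (g v) = χ v) ∧ ∀ u ∈ U, g u = u} : ℝ) *
      (d / 9) ^ U.card ≤ Fintype.card {g : Equiv.Perm V // ∀ v, χ (g v) = χ v} := by
  -- Refine the colouring by giving every element of `U` a colour of its own. The order of the
  -- stabilizer of a colouring is the product of the factorials of its class sizes.
  set f : V → V ⊕ Fin ℓ := fun a => if a ∈ U then Sum.inl a else Sum.inr (χ a) with hf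
  have h1 : Fintype.card {g : Equiv.Perm V // (∀ v, χ (g v) = χ v) ∧ ∀ u ∈ U, g u = u} ≤
      ∏ j, (Finset.univ.filter fun v => v ∉ U ∧ χ v = j).card.factorial := by
    have e1 : Fintype.card {g : Equiv.Perm V // f ∘ g = f} =
        ∏ i, (Fintype.card {a // f a = i}).factorial := DomMulAct.stabilizer_card f
    calc _ ≤ Fintype.card {g : Equiv.Perm V // f ∘ g = f} := by
          refine Fintype.card_subtype_mono _ _ ?_
          rintro g ⟨hg1, hg2⟩
          funext a
          simp only [hf, Function.comp]
          by_cases ha : a ∈ U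
          · rw [hg2 a ha]
          · have : g a ∉ U := fun h => ha (by
              have := g.injective (hg2 _ h)
              rwa [this] at h)
            rw [if_neg ha, if_neg this, hg1]
      _ = _ := e1
      _ = _ := by
          rw [Fintype.prod_sum_type, Finset.prod_eq_one, one_mul]
          · refine Finset.prod_congr rfl fun j _ => ?_
            rw [Fintype.card_subtype]
            congr 2
            ext a
            simp only [hf, Finset.mem_filter, Finset.mem_univ, true_and]
            by_cases ha : a ∈ U <;> simp [ha]
          · intro a _
            have : Fintype.card {b // f b = Sum.inl a} ≤ 1 := by
              rw [Fintype.card_le_one_iff]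
              rintro ⟨b, hb⟩ ⟨c, hc⟩
              simp only [hf] at hb hc
              split_ifs at hb hc
              simp only [Sum.inl.injEq] at hb hc
              simp [hb, hc]
            interval_cases Fintype.card {b // f b = Sum.inl a} <;> rfl
  have h2 : Fintype.card {g : Equiv.Perm V // ∀ v, χ (g v) = χ v} =
      ∏ j, (Finset.univ.filter fun v => χ v = j).card.factorial := by
    have e1 : Fintype.card {g : Equiv.Perm V // χ ∘ g = χ} =
        ∏ i, (Fintype.card {a // χ a = i}).factorial := DomMulAct.stabilizer_card χ
    simp only [Fintype.card_subtype] at e1 ⊢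
    rw [← e1]
    congr 1
    ext g
    simp [funext_iff]
  have h3 : U.card = ∑ j, (Finset.univ.filter fun v => v ∈ U ∧ χ v = j).card := by
    rw [Finset.card_eq_sum_card_fiberwise (f := χ) (t := Finset.univ) fun _ _ => by simp]
    refine Finset.sum_congr rfl fun j _ => ?_
    congr 1
    ext v
    simp
  rw [h2, h3, ← Finset.prod_pow_eq_pow_sum]
  calc _ ≤ (∏ j, ((Finset.univ.filter fun v => v ∉ U ∧ χ v = j).card.factorial : ℝ)) *
        ∏ j, (d / 9) ^ (Finset.univ.filter fun v => v ∈ U ∧ χ v = j).card := by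
        gcongr
        exact_mod_cast h1
    _ ≤ _ := by
        rw [← Finset.prod_mul_distrib]
        push_cast
        refine Finset.prod_le_prod (fun _ _ => by positivity) fun j _ => ?_
        have e : (Finset.univ.filter fun v => χ v = j).card =
            (Finset.univ.filter fun v => v ∉ U ∧ χ v = j).card +
              (Finset.univ.filter fun v => v ∈ U ∧ χ v = j).card := by
          rw [← Finset.card_filter_add_card_filter_not (s := Finset.univ.filter fun v => χ v = j)
            (fun v => v ∉ U), Finset.filter_filter, Finset.filter_filter]
          simp only [not_not]
          congr 3 <;> ext <;> simp [and_comm]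
        have h4 := hχ j
        rw [e] at h4 ⊢
        refine le_trans ?_ (factorial_mul_div_nine_pow_le _ _)
        gcongr

end Perm

/-! ### The family of patterned Hamilton cycles -/

section Pattern

variable {n ℓ : ℕ}

/-- The bijections from positions to vertices under which every vertex has the colour prescribed for
its position. -/
def patternPerms (χ c₂ : Fin n → Fin ℓ) : Finset (Equiv.Perm (Fin n)) :=
  Finset.univ.filter fun σ => ∀ i, χ (σ i) = c₂ i

lemma patternPerms_nonempty (χ c₂ : Fin n → Fin ℓ)
    (h : ∀ j, (Finset.univ.filter fun v => χ v = j).card =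
      (Finset.univ.filter fun v => c₂ v = j).card) : (patternPerms χ c₂).Nonempty := by
  have e : ∀ j, Nonempty ({v // c₂ v = j} ≃ {v // χ v = j}) := fun j => by
    rw [← Fintype.card_eq, Fintype.card_subtype, Fintype.card_subtype, h]
  refine ⟨Equiv.ofFiberEquiv fun j => (e j).some, ?_⟩
  simp only [patternPerms, Finset.mem_filter, Finset.mem_univ, true_and]
  exact fun i => Equiv.ofFiberEquiv_map _ i

/-- Composing with the inverse of one solution `σ₁` turns solutions into colour preserving
permutations that fix `U`, and composing with `σ₁` turns colour preserving permutations into pattern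
bijections. -/
lemma card_patternPerms_agree_mul_le (χ c₂ : Fin n → Fin ℓ) {d : ℝ} (hd : 0 ≤ d)
    (hχ : ∀ j, d ≤ ((Finset.univ.filter fun v => χ v = j).card : ℝ)) (U : Finset (Fin n))
    (a : Fin n → Fin n) :
    (((patternPerms χ c₂).filter fun σ => ∀ u ∈ U, σ.symm u = a u).card : ℝ) *
      (d / 9) ^ U.card ≤ (patternPerms χ c₂).card := by
  rcases ((patternPerms χ c₂).filter fun σ => ∀ u ∈ U, σ.symm u = a u).eq_empty_or_nonempty with
    h | ⟨σ₁, h₁⟩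
  · rw [h]
    simp
  simp only [patternPerms, Finset.mem_filter, Finset.mem_univ, true_and] at h₁
  have hsym : ∀ v, c₂ (σ₁.symm v) = χ v := fun v => by rw [← h₁.1, Equiv.apply_symm_apply]
  have h2 : ((patternPerms χ c₂).filter fun σ => ∀ u ∈ U, σ.symm u = a u).card ≤
      Fintype.card {g : Equiv.Perm (Fin n) // (∀ v, χ (g v) = χ v) ∧ ∀ u ∈ U, g u = u} := by
    rw [Fintype.card_subtype]
    refine Finset.card_le_card_of_injOn (fun σ => σ₁.symm.trans σ) ?_ ?_
    · intro σ hσ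
      simp only [patternPerms, Finset.coe_filter, Finset.mem_filter, Finset.mem_univ, true_and,
        Set.mem_ofPred_eq, Equiv.trans_apply] at hσ ⊢
      refine ⟨fun v => by rw [hσ.1, hsym], fun u hu => ?_⟩
      rw [h₁.2 u hu, ← hσ.2 u hu, Equiv.apply_symm_apply]
    · intro σ _ σ' _ h
      ext i
      have := congrArg (fun g : Equiv.Perm (Fin n) => g (σ₁ i)) h
      simpa using congrArg Fin.val this
  have h3 : Fintype.card {g : Equiv.Perm (Fin n) // ∀ v, χ (g v) = χ v} ≤
      (patternPerms χ c₂).card := by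
    rw [Fintype.card_subtype]
    refine Finset.card_le_card_of_injOn (fun g => σ₁.trans g) ?_ ?_
    · intro g hg
      simp only [patternPerms, Finset.coe_filter, Finset.mem_univ, true_and,
        Set.mem_ofPred_eq, Equiv.trans_apply] at hg ⊢
      exact fun i => by rw [hg, h₁.1]
    · intro g _ g' _ h
      ext i
      have := congrArg (fun g : Equiv.Perm (Fin n) => g (σ₁.symm i)) h
      simpa using congrArg Fin.val this
  calc _ ≤ (Fintype.card {g : Equiv.Perm (Fin n) // (∀ v, χ (g v) = χ v) ∧ ∀ u ∈ U, g u = u} : ℝ)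
        * (d / 9) ^ U.card := by gcongr
    _ ≤ (Fintype.card {g : Equiv.Perm (Fin n) // ∀ v, χ (g v) = χ v} : ℝ) := by
        convert card_perm_fixing_mul_le χ hd hχ U
    _ ≤ _ := Nat.cast_le.2 h3

variable [NeZero n]

/-- The edges of the cycle `σ 0, σ 1, …, σ (n - 1), σ 0`. -/
def cycleEdges (σ : Equiv.Perm (Fin n)) : Finset (Sym2 (Fin n)) :=
  Finset.univ.image fun i => s(σ i, σ (i + 1))

lemma fin_one_add_one_ne_zero (hn : 3 ≤ n) : (1 : Fin n) + 1 ≠ 0 := by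
  intro h
  have := congrArg Fin.val h
  rw [Fin.val_add, Fin.val_one', Fin.val_zero, Nat.mod_eq_of_lt (by omega : 1 < n),
    Nat.mod_eq_of_lt (by omega : 1 + 1 < n)] at this
  omega

lemma cycle_edge_injective (hn : 3 ≤ n) (σ : Equiv.Perm (Fin n)) :
    Function.Injective fun i => s(σ i, σ (i + 1)) := by
  intro i j h
  simp only [Sym2.eq_iff, EmbeddingLike.apply_eq_iff_eq] at h
  rcases h with h | ⟨h1, h2⟩
  · exact h.1
  · exfalso
    apply fin_one_add_one_ne_zero hn
    have : j + (1 + 1) = j + 0 := by rw [← add_assoc, ← h1, h2, add_zero]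
    exact add_left_cancel this

/-- If the cycle of `σ₀` contains the edges with indices in `I`, where `I` misses an index, then
the positions of their endpoints under any `σ` whose cycle contains these edges are determined by
the positions of the first vertices of the paths and by the directions of the edges. -/
lemma symm_eq_of_code_eq {σ₀ σ σ' : Equiv.Perm (Fin n)} {I : Finset (Fin n)} {r : Fin n}
    (hr : r ∉ I)
    (hσ : ∀ i ∈ I, σ.symm (σ₀ (i + 1)) = σ.symm (σ₀ i) + 1 ∨
      σ.symm (σ₀ (i + 1)) + 1 = σ.symm (σ₀ i))
    (hσ' : ∀ i ∈ I, σ'.symm (σ₀ (i + 1)) = σ'.symm (σ₀ i) + 1 ∨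
      σ'.symm (σ₀ (i + 1)) + 1 = σ'.symm (σ₀ i))
    (hstart : ∀ i ∈ I, i - 1 ∉ I → σ.symm (σ₀ i) = σ'.symm (σ₀ i))
    (hdir : ∀ i ∈ I, (σ.symm (σ₀ (i + 1)) = σ.symm (σ₀ i) + 1 ↔
      σ'.symm (σ₀ (i + 1)) = σ'.symm (σ₀ i) + 1))
    (i : Fin n) (hi : i ∈ I ∨ i - 1 ∈ I) : σ.symm (σ₀ i) = σ'.symm (σ₀ i) := by
  -- As `r ∉ I`, no path runs from `r` to `r + 1`. Cutting the cycle there allows induction on the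
  -- distance from `r + 1`.
  have key : ∀ k : ℕ, ∀ i : Fin n, (i - (r + 1)).val = k → (i ∈ I ∨ i - 1 ∈ I) →
      σ.symm (σ₀ i) = σ'.symm (σ₀ i) := by
    intro k
    induction k with
    | zero =>
      intro i hi h
      rw [Fin.val_eq_zero_iff, sub_eq_zero] at hi
      have h' : i - 1 ∉ I := by rwa [hi, add_sub_cancel_right]
      exact hstart i (h.resolve_right h') h'
    | succ k ih =>
      intro i hi h
      by_cases h' : i - 1 ∈ I
      · have h0 : i - (r + 1) ≠ 0 := fun h => by simp [h] at hi
        have h1 := ih (i - 1) (by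
          rw [sub_right_comm, Fin.val_sub_one_of_ne_zero h0, hi]
          rfl) (Or.inl h')
        have h2 := hσ _ h'
        have h3 := hσ' _ h'
        have h4 := hdir _ h'
        rw [sub_add_cancel] at h2 h3 h4
        by_cases h5 : σ.symm (σ₀ i) = σ.symm (σ₀ (i - 1)) + 1
        · rw [h5, h4.1 h5, h1]
        · have h6 := h2.resolve_left h5
          have h7 := h3.resolve_left fun h => h5 (h4.2 h)
          exact add_right_cancel (h6.trans (h1.trans h7.symm))
      · exact hstart i (h.resolve_right h') h'
  exact key _ i rfl hi

/-- The number of patterned cycles containing a given proper part of a patterned cycle. -/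
lemma card_cycles_containing_mul_le (χ c₂ : Fin n → Fin ℓ) {d : ℝ} (hd : 0 ≤ d)
    (hχ : ∀ j, d ≤ ((Finset.univ.filter fun v => χ v = j).card : ℝ))
    (σ₀ : Equiv.Perm (Fin n)) {I : Finset (Fin n)} {r : Fin n} (hr : r ∉ I) :
    (((patternPerms χ c₂).filter fun σ => ∀ i ∈ I, s(σ₀ i, σ₀ (i + 1)) ∈ cycleEdges σ).card : ℝ) *
      (d / 9) ^ (I.card + (I.filter fun i => i - 1 ∉ I).card) ≤
      (n : ℝ) ^ (I.filter fun i => i - 1 ∉ I).card * 2 ^ I.card * (patternPerms χ c₂).card := by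
  classical
  set S := I.filter fun i => i - 1 ∉ I with hS
  set F := (patternPerms χ c₂).filter fun σ => ∀ i ∈ I, s(σ₀ i, σ₀ (i + 1)) ∈ cycleEdges σ with hF
  -- The vertices covered by the paths: `S` holds the indices of their first vertices, and each edge
  -- adds its second endpoint.
  set U := (S ∪ I.image (· + 1)).image σ₀ with hU
  have hUcard : U.card = I.card + S.card := by
    rw [hU, Finset.card_image_of_injective _ σ₀.injective, Finset.card_union_of_disjoint,
      Finset.card_image_of_injective _ (add_left_injective 1), add_comm]
    rw [Finset.disjoint_left]
    intro i hi hi'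
    obtain ⟨j, hj, rfl⟩ := Finset.mem_image.1 hi'
    rw [hS, Finset.mem_filter, add_sub_cancel_right] at hi
    exact hi.2 hj
  set code : Equiv.Perm (Fin n) → (S → Fin n) × (I → Bool) := fun σ =>
    (fun i => σ.symm (σ₀ i), fun i => decide (σ.symm (σ₀ (i + 1)) = σ.symm (σ₀ i) + 1)) with hcode
  have hedge : ∀ σ ∈ F, ∀ i ∈ I, σ.symm (σ₀ (i + 1)) = σ.symm (σ₀ i) + 1 ∨
      σ.symm (σ₀ (i + 1)) + 1 = σ.symm (σ₀ i) := by
    intro σ hσ i hi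
    have := (Finset.mem_filter.1 hσ).2 i hi
    obtain ⟨j, _, hj⟩ := Finset.mem_image.1 this
    rcases Sym2.eq_iff.1 hj with ⟨h1, h2⟩ | ⟨h1, h2⟩
    · left
      rw [← h1, ← h2]
      simp
    · right
      rw [← h1, ← h2]
      simp
  have hfib : ∀ c, ((F.filter fun σ => code σ = c).card : ℝ) * (d / 9) ^ U.card ≤
      (patternPerms χ c₂).card := by
    intro c
    rcases (F.filter fun σ => code σ = c).eq_empty_or_nonempty with h | ⟨σ₁, h₁⟩
    · rw [h]
      simp
    rw [Finset.mem_filter] at h₁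
    refine le_trans ?_ (card_patternPerms_agree_mul_le χ c₂ hd hχ U fun u => σ₁.symm u)
    gcongr
    intro σ hσ
    rw [Finset.mem_filter] at hσ
    rw [Finset.mem_filter]
    refine ⟨(Finset.mem_filter.1 hσ.1).1, fun u hu => ?_⟩
    obtain ⟨i, hi, rfl⟩ := Finset.mem_image.1 hu
    have hc : code σ = code σ₁ := hσ.2.trans h₁.2.symm
    simp only [hcode, Prod.mk.injEq] at hc
    refine symm_eq_of_code_eq hr (hedge σ hσ.1) (hedge σ₁ h₁.1) (fun i hi hi' => ?_)
      (fun i hi => ?_) i ?_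
    · exact congrFun hc.1 ⟨i, Finset.mem_filter.2 ⟨hi, hi'⟩⟩
    · simpa using congrFun hc.2 ⟨i, hi⟩
    · rcases Finset.mem_union.1 hi with h | h
      · exact Or.inl (Finset.mem_filter.1 h).1
      · obtain ⟨j, hj, rfl⟩ := Finset.mem_image.1 h
        right
        rwa [add_sub_cancel_right]
  rw [← hUcard, Finset.card_eq_sum_card_fiberwise (f := code) (t := Finset.univ)
    fun _ _ => by simp]
  push_cast
  rw [Finset.sum_mul]
  calc _ ≤ ∑ _c : (S → Fin n) × (I → Bool), ((patternPerms χ c₂).card : ℝ) :=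
        Finset.sum_le_sum fun c _ => hfib c
    _ = _ := by simp

/-- The family of patterned cycles is spread, at the level of edge sets. -/
lemma card_filter_subset_cycleEdges_le (hn : 3 ≤ n) (χ c₂ : Fin n → Fin ℓ) {δ : ℝ} (hδ : 0 < δ)
    (hδ1 : δ ≤ 1) (hχ : ∀ j, δ * n ≤ ((Finset.univ.filter fun v => χ v = j).card : ℝ))
    (F : Finset (Sym2 (Fin n))) :
    (((patternPerms χ c₂).filter fun σ => F ⊆ cycleEdges σ).card : ℝ) ≤
      (324 / δ ^ 2 / n) ^ F.card * (patternPerms χ c₂).card := by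
  have hn0 : (0 : ℝ) < n := by exact_mod_cast (by omega : 0 < n)
  rcases ((patternPerms χ c₂).filter fun σ => F ⊆ cycleEdges σ).eq_empty_or_nonempty with
    h | ⟨σ₀, h₀⟩
  · rw [h]
    simp only [Finset.card_empty, Nat.cast_zero]
    positivity
  have hF₀ := (Finset.mem_filter.1 h₀).2
  set I := Finset.univ.filter fun i => s(σ₀ i, σ₀ (i + 1)) ∈ F with hI
  have hFI : I.image (fun i => s(σ₀ i, σ₀ (i + 1))) = F := by
    ext e
    constructor
    · intro he
      obtain ⟨i, hi, rfl⟩ := Finset.mem_image.1 he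
      exact (Finset.mem_filter.1 hi).2
    · intro he
      obtain ⟨i, _, rfl⟩ := Finset.mem_image.1 (hF₀ he)
      exact Finset.mem_image.2 ⟨i, Finset.mem_filter.2 ⟨Finset.mem_univ _, he⟩, rfl⟩
  have hcard : F.card = I.card := by
    rw [← hFI, Finset.card_image_of_injective _ (cycle_edge_injective hn σ₀)]
  have main : ∀ J ⊆ I, ∀ r, r ∉ J →
      (((patternPerms χ c₂).filter fun σ => F ⊆ cycleEdges σ).card : ℝ) ≤
        (162 / δ ^ 2 / n) ^ J.card * (patternPerms χ c₂).card := by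
    intro J hJ r hr
    have h1 := card_cycles_containing_mul_le χ c₂ (by positivity) hχ σ₀ hr
    set t := (J.filter fun i => i - 1 ∉ J).card with ht
    have htJ : t ≤ J.card := Finset.card_filter_le _ _
    have h2 : (((patternPerms χ c₂).filter fun σ => F ⊆ cycleEdges σ).card : ℝ) ≤
        ((patternPerms χ c₂).filter
          fun σ => ∀ i ∈ J, s(σ₀ i, σ₀ (i + 1)) ∈ cycleEdges σ).card := by
      gcongr with σ
      exact fun h i hi => h (Finset.mem_filter.1 (hJ hi)).2
    set N := (((patternPerms χ c₂).filter fun σ => F ⊆ cycleEdges σ).card : ℝ)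
    have h3 : N * (δ * n / 9) ^ (J.card + t) ≤
        (n : ℝ) ^ t * 2 ^ J.card * (patternPerms χ c₂).card :=
      (mul_le_mul_of_nonneg_right h2 (by positivity)).trans h1
    -- There are at most as many paths as edges, so the exponent of `δ / 9` is at most `2 * J.card`;
    -- this gives the constant `2 * 81 = 162`.
    have h4 : (δ / 9) ^ J.card ≤ (δ / 9) ^ t :=
      pow_le_pow_of_le_one (by positivity) (by linarith) htJ
    have h5 : N * ((δ / 9) ^ J.card * (δ / 9) ^ J.card * n ^ J.card) ≤
        2 ^ J.card * (patternPerms χ c₂).card := by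
      have h6 : (n : ℝ) ^ t * (N * ((δ / 9) ^ J.card * (δ / 9) ^ J.card * n ^ J.card)) ≤
          (n : ℝ) ^ t * (2 ^ J.card * (patternPerms χ c₂).card) := by
        calc _ ≤ (n : ℝ) ^ t * (N * ((δ / 9) ^ J.card * (δ / 9) ^ t * n ^ J.card)) := by gcongr
          _ = N * (δ * n / 9) ^ (J.card + t) := by
            rw [pow_add, show δ * n / 9 = δ / 9 * n by ring, mul_pow, mul_pow]
            ring
          _ ≤ _ := h3
          _ = _ := by ring
      exact le_of_mul_le_mul_left h6 (by positivity)
    have e : (162 / δ ^ 2 / n : ℝ) ^ J.card =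
        2 ^ J.card / ((δ / 9) ^ J.card * (δ / 9) ^ J.card * n ^ J.card) := by
      rw [← mul_pow, ← mul_pow, ← div_pow]
      congr 1
      field_simp
      norm_num
    rw [e, div_mul_eq_mul_div, le_div_iff₀ (by positivity)]
    exact h5
  have hC : (1 : ℝ) ≤ 162 / δ ^ 2 := by
    rw [le_div_iff₀ (by positivity)]
    nlinarith
  by_cases hIu : ∃ r, r ∉ I
  · obtain ⟨r, hr⟩ := hIu
    refine (main I subset_rfl r hr).trans ?_
    rw [hcard]
    gcongr
    norm_num
  -- `F` is an entire cycle. One edge is dropped, and the lost factor of order `1 / n` is paid for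
  -- by doubling `162` to `324`, because `n ≤ 2 ^ n`.
  · push Not at hIu
    have hIn : I.card = n := by
      rw [Finset.eq_univ_iff_forall.2 hIu, Finset.card_univ, Fintype.card_fin]
    refine (main (I.erase 0) (Finset.erase_subset _ _) 0 (Finset.notMem_erase _ _)).trans ?_
    gcongr
    rw [Finset.card_erase_of_mem (hIu 0), hcard, hIn]
    obtain ⟨m, rfl⟩ : ∃ m, n = m + 1 := ⟨n - 1, by omega⟩
    have h2 : ((m + 1 : ℕ) : ℝ) ≤ 2 ^ (m + 1) := by
      exact_mod_cast (Nat.lt_two_pow_self (n := m + 1)).le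
    have h3 : (1 : ℝ) ≤ 2 ^ (m + 1) * (162 / δ ^ 2 / (m + 1 : ℕ)) := by
      rw [← mul_div_assoc, le_div_iff₀ hn0]
      nlinarith
    rw [Nat.add_sub_cancel]
    calc (162 / δ ^ 2 / ((m + 1 : ℕ) : ℝ)) ^ m
        ≤ (162 / δ ^ 2 / ((m + 1 : ℕ) : ℝ)) ^ m *
          (2 ^ (m + 1) * (162 / δ ^ 2 / (m + 1 : ℕ))) :=
          le_mul_of_one_le_right (by positivity) h3
      _ = (2 * (162 / δ ^ 2 / ((m + 1 : ℕ) : ℝ))) ^ (m + 1) := by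
          rw [mul_pow, pow_succ (162 / δ ^ 2 / ((m + 1 : ℕ) : ℝ))]
          ring
      _ = _ := by
          congr 1
          ring

/-- The edges of the cycle of `σ`, each with its prescribed colour. -/
def colouredCycle {k : ℕ} (c₁ : Fin n → Fin k) (σ : Equiv.Perm (Fin n)) :
    Finset (Sym2 (Fin n) × Fin k) :=
  Finset.univ.image fun i => (s(σ i, σ (i + 1)), c₁ i)

lemma card_colouredCycle_le {k : ℕ} (c₁ : Fin n → Fin k) (σ : Equiv.Perm (Fin n)) :
    (colouredCycle c₁ σ).card ≤ n :=
  Finset.card_image_le.trans (by simp)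

lemma colouredCycle_fst_injOn (hn : 3 ≤ n) {k : ℕ} (c₁ : Fin n → Fin k) (σ : Equiv.Perm (Fin n)) :
    Set.InjOn Prod.fst (colouredCycle c₁ σ : Set (Sym2 (Fin n) × Fin k)) := by
  intro x hx y hy h
  obtain ⟨i, _, rfl⟩ := Finset.mem_image.1 hx
  obtain ⟨j, _, rfl⟩ := Finset.mem_image.1 hy
  rw [cycle_edge_injective hn σ h]

lemma image_fst_colouredCycle {k : ℕ} (c₁ : Fin n → Fin k) (σ : Equiv.Perm (Fin n)) :
    (colouredCycle c₁ σ).image Prod.fst = cycleEdges σ := by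
  rw [colouredCycle, Finset.image_image]
  rfl

/-- Only sets `T` inside some coloured cycle matter. Such a `T` has one colour per edge, so
forgetting the colours keeps its size and the bound for edge sets applies. -/
lemma isSpread_colouredCycle (hn : 3 ≤ n) {k : ℕ} (c₁ : Fin n → Fin k) (χ c₂ : Fin n → Fin ℓ)
    {δ : ℝ} (hδ : 0 < δ) (hδ1 : δ ≤ 1)
    (hχ : ∀ j, δ * n ≤ ((Finset.univ.filter fun v => χ v = j).card : ℝ))
    (hne : (patternPerms χ c₂).Nonempty) :
    IsSpread (fun _ => ((patternPerms χ c₂).card : ℝ)⁻¹) (324 / δ ^ 2 / n) (patternPerms χ c₂)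
      (colouredCycle c₁) := by
  intro T
  have hpos : (0 : ℝ) < (patternPerms χ c₂).card := by exact_mod_cast hne.card_pos
  rw [Finset.sum_const, nsmul_eq_mul, ← div_eq_mul_inv, div_le_iff₀ hpos]
  rcases ((patternPerms χ c₂).filter fun σ => T ⊆ colouredCycle c₁ σ).eq_empty_or_nonempty with
    h | ⟨σ₀, h₀⟩
  · rw [h]
    simp only [Finset.card_empty, Nat.cast_zero]
    positivity
  have hc : (T.image Prod.fst).card = T.card :=
    Finset.card_image_of_injOn ((colouredCycle_fst_injOn hn c₁ σ₀).mono
      (by exact_mod_cast (Finset.mem_filter.1 h₀).2))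
  rw [← hc]
  refine le_trans ?_ (card_filter_subset_cycleEdges_le hn χ c₂ hδ hδ1 hχ _)
  gcongr with σ
  intro h
  rw [← image_fst_colouredCycle c₁ σ]
  exact Finset.image_subset_image h

end Pattern

/-! ### From adjacency to Hamilton cycles -/

section Hamilton

lemma hasPatternedHamiltonCycle_of_perm {n k ℓ : ℕ} [NeZero n] (hn : 3 ≤ n)
    {G : SimpleGraph (Fin n)} {c : Sym2 (Fin n) → Fin k} {χ : Fin n → Fin ℓ} {c₁ : Fin n → Fin k}
    {c₂ : Fin n → Fin ℓ} (σ : Equiv.Perm (Fin n)) (hG : ∀ i, G.Adj (σ i) (σ (i + 1)))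
    (hc : ∀ i, c s(σ i, σ (i + 1)) = c₁ i) (hχ : ∀ i, χ (σ i) = c₂ i) :
    HasPatternedHamiltonCycle G c χ c₁ c₂ := by
  obtain ⟨m, rfl⟩ : ∃ m, n = m + 3 := ⟨n - 3, by omega⟩
  have hadj : ∀ u v : Fin (m + 3), (SimpleGraph.cycleGraph (m + 3)).Adj u v →
      G.Adj (σ (-u)) (σ (-v)) := by
    intro u v h
    rcases SimpleGraph.cycleGraph_adj.1 h with h | h
    · have := hG (-u)
      rwa [show -u + 1 = -v by rw [← h]; abel] at this
    · have := hG (-v)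
      rw [show -v + 1 = -u by rw [← h]; abel] at this
      exact this.symm
  -- The standard closed walk visits the vertices in decreasing order, hence the sign.
  let f : SimpleGraph.cycleGraph (m + 3) →g G := ⟨fun u => σ (-u), fun {u v} h => hadj u v h⟩
  have hf : Function.Bijective f := σ.bijective.comp (Equiv.neg (Fin (m + 3))).bijective
  have hget : ∀ i : ℕ, i ≤ m + 3 →
      ((SimpleGraph.cycleGraph.cycle m).map f).getVert i = σ (Fin.ofNat (m + 3) i) := by
    intro i hi
    rw [SimpleGraph.Walk.getVert_map, SimpleGraph.cycleGraph.getVert_cycle hi]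
    change σ (-_) = _
    congr 1
    rw [neg_eq_iff_add_eq_zero]
    ext
    simp only [Fin.val_add, Fin.ofNat, Fin.val_zero, ← Nat.add_mod]
    rw [Nat.sub_add_cancel hi, Nat.mod_self]
  have hi0 : ∀ i : Fin (m + 3), Fin.ofNat (m + 3) (i : ℕ) = i := fun i => by
    ext
    simp [Fin.ofNat, Nat.mod_eq_of_lt i.2]
  have hi1 : ∀ i : Fin (m + 3), Fin.ofNat (m + 3) ((i : ℕ) + 1) = i + 1 := fun i => by
    ext
    simp [Fin.ofNat, Fin.val_add]
  refine ⟨f 0, (SimpleGraph.cycleGraph.cycle m).map f, ?_, fun i => ?_, fun i => ?_⟩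
  · refine SimpleGraph.Walk.IsHamiltonianCycle.map hf ?_
    rw [SimpleGraph.Walk.isHamiltonianCycle_iff_isCycle_and_length_eq]
    exact ⟨SimpleGraph.cycleGraph.isCycle_cycle, by simp [SimpleGraph.cycleGraph.length_cycle]⟩
  · rw [hget _ i.2.le, hget _ i.2, hi0, hi1, hc]
  · rw [hget _ i.2.le, hi0, hχ]

end Hamilton

/-! ### Comparison of product measures -/

section Comparison

variable {ι : Type*} [DecidableEq ι] {X : ι → Type*} [∀ i, MeasurableSpace (X i)]

/-- Hybrid argument: the measures are exchanged one coordinate at a time, with all others frozen. -/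
lemma lmarginal_le_lmarginal_of_forall_le (μ ν : ∀ i, Measure (X i)) [∀ i, SigmaFinite (μ i)]
    [∀ i, SigmaFinite (ν i)] {f : (∀ i, X i) → ENNReal} (hf : Measurable f)
    (h : ∀ i x, ∫⁻ y, f (Function.update x i y) ∂μ i ≤ ∫⁻ y, f (Function.update x i y) ∂ν i)
    (s : Finset ι) (x : ∀ i, X i) : lmarginal μ s f x ≤ lmarginal ν s f x := by
  induction s using Finset.induction_on generalizing x with
  | empty => simp
  | insert i s hi ih =>
    -- The hybrid measure, `μ` at `i` and `ν` elsewhere, is what allows the order of integration to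
    -- be swapped by Fubini.
    have hsf : ∀ j, SigmaFinite (Function.update ν i (μ i) j) := by
      intro j
      rcases eq_or_ne j i with rfl | hj
      · simp only [Function.update_self]
        infer_instance
      · rw [Function.update_of_ne hj]
        infer_instance
    have e : ∀ g : (∀ i, X i) → ENNReal,
        lmarginal (Function.update ν i (μ i)) s g = lmarginal ν s g := by
      intro g
      have e1 : (fun j : s => Function.update ν i (μ i) j) = fun j : s => ν j := by
        funext j
        exact Function.update_of_ne (fun h => hi (by rw [← h]; exact j.2)) _ _
      unfold lmarginal
      rw [e1]
    calc lmarginal μ (insert i s) f x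
        = ∫⁻ y, lmarginal μ s f (Function.update x i y) ∂μ i := lmarginal_insert f hf hi x
      _ ≤ ∫⁻ y, lmarginal ν s f (Function.update x i y) ∂μ i := lintegral_mono fun y => ih _
      _ = lmarginal (Function.update ν i (μ i)) (insert i s) f x := by
          rw [lmarginal_insert f hf hi x, e, Function.update_self]
      _ = lmarginal ν s (fun x => ∫⁻ y, f (Function.update x i y) ∂μ i) x := by
          rw [lmarginal_insert' f hf hi, e, Function.update_self]
      _ ≤ lmarginal ν s (fun x => ∫⁻ y, f (Function.update x i y) ∂ν i) x :=
          lmarginal_mono (fun x => h i x) x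
      _ = lmarginal ν (insert i s) f x := by rw [lmarginal_insert' f hf hi]

end Comparison

/-! ### Exclusive edge colours compared with independent ones -/

section Coupling

open ProbabilityTheory unitInterval

/-- The Bernoulli law on propositions. -/
noncomputable def bernProp (q : I) : Measure Prop :=
  toNNReal q • Measure.dirac True + toNNReal (σ q) • Measure.dirac False

instance (q : I) : IsProbabilityMeasure (bernProp q) := by
  unfold bernProp
  infer_instance

lemma bernProp_real_singleton (q : I) (P : Prop) [Decidable P] :
    (bernProp q).real {P} = if P then (q : ℝ) else 1 - q := by
  by_cases hP : P
  · simp [bernProp, measureReal_def, hP]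
  · simp [bernProp, measureReal_def, hP]

lemma bernProp_true (q : I) : bernProp q {True} = ENNReal.ofReal q := by
  rw [← ofReal_measureReal, bernProp_real_singleton, if_pos trivial]

variable {E C : Type*}

/-- The law of the set of colours of an edge that gets every colour independently with
probability `q`. -/
noncomputable def indepColours (C : Type*) [Fintype C] (q : I) : Measure (C → Prop) :=
  Measure.pi fun _ => bernProp q

instance [Fintype C] (q : I) : IsProbabilityMeasure (indepColours C q) := by
  unfold indepColours
  infer_instance

lemma indepColours_apply_le [Fintype C] (q : I) (D : Finset C) :
    indepColours C q {y | ∃ c ∈ D, y c} ≤ D.card * ENNReal.ofReal q := by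
  have h1 : {y : C → Prop | ∃ c ∈ D, y c} = ⋃ c ∈ D, {y | y c} := by
    ext y
    simp
  rw [h1]
  refine (measure_biUnion_finset_le D _).trans ?_
  rw [← nsmul_eq_mul, ← Finset.sum_const]
  refine (Finset.sum_congr rfl fun c _ => ?_).le
  have h2 : {y : C → Prop | y c} = Function.eval c ⁻¹' ({True} : Set Prop) := by
    ext y
    simp
  rw [h2, ← bernProp_true q]
  exact (measurePreserving_eval (fun _ : C => bernProp q) c).measure_preimage
    (MeasurableSet.of_discrete).nullMeasurableSet

/-- The indicator of the set of colours of an edge `e`, where only pairs of distinct vertices can be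
present. -/
def edgeColours {V C : Type*} (e : Sym2 V) (x : Prop × C) : C → Prop :=
  fun c => ¬ e.IsDiag ∧ x.1 ∧ x.2 = c

/-- The law of the set of colours of the pair `e` in the coloured random graph. -/
noncomputable def exclColours {V : Type*} {k : ℕ} (p : I) (α : PMF (Fin k)) (e : Sym2 V) :
    Measure (Fin k → Prop) :=
  ((toNNReal p • Measure.dirac (e ∈ (Sym2.diagSetᶜ : Set (Sym2 V))) +
    toNNReal (σ p) • Measure.dirac False).prod α.toMeasure).map (edgeColours e)

instance {V : Type*} {k : ℕ} (p : I) (α : PMF (Fin k)) (e : Sym2 V) :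
    IsProbabilityMeasure (exclColours p α e) :=
  Measure.isProbabilityMeasure_map Measurable.of_discrete.aemeasurable

lemma exclColours_apply {V : Type*} {k : ℕ} (p : I) (α : PMF (Fin k)) {e : Sym2 V}
    (he : ¬ e.IsDiag) (D : Finset (Fin k)) :
    exclColours p α e {y | ∃ c ∈ D, y c} = ENNReal.ofReal p * ∑ c ∈ D, α c := by
  have h1 : edgeColours e ⁻¹' {y : Fin k → Prop | ∃ c ∈ D, y c} =
      ({True} : Set Prop) ×ˢ (D : Set (Fin k)) := by
    ext ⟨P, c⟩
    simp [edgeColours, he, and_comm]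
  have h2 : (e ∈ (Sym2.diagSetᶜ : Set (Sym2 V))) = True := by simpa using he
  rw [exclColours, Measure.map_apply Measurable.of_discrete MeasurableSet.of_discrete, h1,
    Measure.prod_prod, PMF.toMeasure_apply_finset, h2]
  congr 1
  exact bernProp_true p

lemma measurable_colourSets (n k : ℕ) :
    Measurable fun (X : SimpleGraph (Fin n) × (Sym2 (Fin n) → Fin k))
      (e : Sym2 (Fin n)) (c : Fin k) => e ∈ X.1.edgeSet ∧ X.2 e = c := by
  refine measurable_pi_iff.2 fun e => measurable_pi_iff.2 fun c => ?_
  refine Measurable.and ?_ ?_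
  · exact (measurable_set_iff.1 SimpleGraph.measurable_edgeSet e).comp measurable_fst
  · have : Measurable fun g : Sym2 (Fin n) → Fin k => g e = c := Measurable.of_discrete
    exact this.comp measurable_snd

/-- Presence and colour are both independent over the pairs, so they can be regrouped into one
independent law per pair. Diagonal pairs never become edges. -/
lemma map_coloredRandomGraph (n : ℕ) (p : I) {k : ℕ} (α : PMF (Fin k)) :
    (coloredRandomGraph n p α).map
      (fun X => fun (e : Sym2 (Fin n)) (c : Fin k) => e ∈ X.1.edgeSet ∧ X.2 e = c) =
      Measure.pi fun e : Sym2 (Fin n) => exclColours p α e := by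
  set b : Sym2 (Fin n) → Measure Prop := fun e =>
    toNNReal p • Measure.dirac (e ∈ (Sym2.diagSetᶜ : Set (Sym2 (Fin n)))) +
      toNNReal (σ p) • Measure.dirac False with hb
  have hbp : ∀ e, IsProbabilityMeasure (b e) := fun e => by
    rw [hb]
    infer_instance
  have h1 : SimpleGraph.binomialRandom (Fin n) p =
      (Measure.pi b).map (fun s => SimpleGraph.fromEdgeSet {e | s e}) := by
    rw [SimpleGraph.binomialRandom_eq_map, setBernoulli_eq_map,
      Measure.map_map SimpleGraph.measurable_fromEdgeSet Measurable.of_discrete,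
      Measure.infinitePi_eq_pi]
    rfl
  have hm1 : Measurable fun s : Sym2 (Fin n) → Prop => SimpleGraph.fromEdgeSet {e | s e} :=
    Measurable.of_discrete
  have h2 : coloredRandomGraph n p α =
      (Measure.pi fun e => (b e).prod α.toMeasure).map
        (fun x => (SimpleGraph.fromEdgeSet {e | (x e).1}, fun e => (x e).2)) := by
    rw [coloredRandomGraph, h1]
    have h3 := Measure.map_prod_map (Measure.pi b)
      (Measure.pi fun _ : Sym2 (Fin n) => α.toMeasure) hm1 measurable_id
    rw [Measure.map_id] at h3
    rw [h3, ← (measurePreserving_arrowProdEquivProdArrow Prop (Fin k) (Sym2 (Fin n)) b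
      fun _ => α.toMeasure).map_eq,
      Measure.map_map (hm1.prodMap measurable_id) (MeasurableEquiv.measurable _)]
    rfl
  rw [h2, Measure.map_map (measurable_colourSets n k) Measurable.of_discrete]
  have h4 := Measure.pi_map_pi (μ := fun e => (b e).prod α.toMeasure)
    (f := fun e => edgeColours (C := Fin k) e) fun e => Measurable.of_discrete.aemeasurable
  refine Eq.trans ?_ h4
  congr 1
  funext x e c
  simp only [Function.comp, edgeColours, SimpleGraph.edgeSet_fromEdgeSet, eq_iff_iff]
  simp only [Set.mem_sdiff, Set.mem_ofPred_eq, Sym2.mem_diagSet]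
  tauto

/-- The event that every coloured edge of some member of the family is present. -/
def hitEvent {Ω : Type*} (G : Finset Ω) (A : Ω → Finset (E × C)) : Set (E → C → Prop) :=
  {g | ∃ ω ∈ G, ∀ x ∈ A ω, g x.1 x.2}

/-- Giving each edge an exclusive colour makes a hit at least as likely as giving the colours
independently. -/
lemma indep_hitEvent_le {Ω V : Type*} [Fintype V] [DecidableEq V] {k : ℕ} (p q : I)
    (α : PMF (Fin k)) (hq : ∀ c, ENNReal.ofReal q ≤ ENNReal.ofReal p * α c) (G : Finset Ω)
    (A : Ω → Finset (Sym2 V × Fin k))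
    (hA : ∀ ω ∈ G, Set.InjOn Prod.fst (A ω : Set (Sym2 V × Fin k)))
    (hd : ∀ ω ∈ G, ∀ x ∈ A ω, ¬ x.1.IsDiag) :
    (Measure.pi fun _ : Sym2 V => indepColours (Fin k) q) (hitEvent G A) ≤
      (Measure.pi fun e : Sym2 V => exclColours p α e) (hitEvent G A) := by
  classical
  rw [← lintegral_indicator_one MeasurableSet.of_discrete,
    ← lintegral_indicator_one MeasurableSet.of_discrete,
    lintegral_eq_lmarginal_univ fun _ _ => False, lintegral_eq_lmarginal_univ fun _ _ => False]
  refine lmarginal_le_lmarginal_of_forall_le _ _ Measurable.of_discrete (fun e x => ?_) _ _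
  have hmono : ∀ y z : Fin k → Prop, (∀ c, y c → z c) →
      Function.update x e y ∈ hitEvent G A → Function.update x e z ∈ hitEvent G A := by
    rintro y z hyz ⟨ω, hω, h⟩
    refine ⟨ω, hω, fun a ha => ?_⟩
    have := h a ha
    by_cases he : a.1 = e
    · rw [he, Function.update_self] at this ⊢
      exact hyz _ this
    · rw [Function.update_of_ne he] at this ⊢
      exact this
  -- With the other edges frozen, either there is a hit without `e`, or a hit means that `e`
  -- receives a colour in a fixed set `D`. The latter has probability at most `D.card * q` under
  -- independent colours and exactly `p * ∑ c ∈ D, α c` under exclusive ones.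
  by_cases h0 : Function.update x e (fun _ => False) ∈ hitEvent G A
  · have h1 : ∀ y, (hitEvent G A).indicator (1 : (Sym2 V → Fin k → Prop) → ENNReal)
        (Function.update x e y) = 1 := fun y =>
      Set.indicator_of_mem (hmono _ y (fun _ h => h.elim) h0) _
    simp only [h1, lintegral_const, measure_univ, le_refl]
  · set D := Finset.univ.filter fun c : Fin k =>
      Function.update x e (fun c' => c' = c) ∈ hitEvent G A with hD
    have hex : ∀ y, Function.update x e y ∈ hitEvent G A →
        ¬ e.IsDiag ∧ ∃ c ∈ D, y c := by
      rintro y ⟨ω, hω, h⟩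
      have h2 : ∃ a ∈ A ω, a.1 = e := by
        by_contra hne
        push Not at hne
        refine h0 ⟨ω, hω, fun a ha => ?_⟩
        have := h a ha
        rwa [Function.update_of_ne (hne a ha)] at this ⊢
      obtain ⟨a, ha, rfl⟩ := h2
      refine ⟨hd ω hω a ha, a.2, ?_, by simpa using h a ha⟩
      rw [hD, Finset.mem_filter]
      refine ⟨Finset.mem_univ _, ω, hω, fun a' ha' => ?_⟩
      -- The member uses `e` only once, so its colour `a.2` alone completes the hit.
      by_cases he : a'.1 = a.1
      · rw [hA ω hω ha' ha he, Function.update_self]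
      · have := h a' ha'
        rwa [Function.update_of_ne he] at this ⊢
    have h1 : ∀ y, (hitEvent G A).indicator (1 : (Sym2 V → Fin k → Prop) → ENNReal)
        (Function.update x e y) = {y : Fin k → Prop | ∃ c ∈ D, y c}.indicator 1 y := by
      intro y
      by_cases hy : ∃ c ∈ D, y c
      · obtain ⟨c, hc, hyc⟩ := hy
        rw [Set.indicator_of_mem, Set.indicator_of_mem]
        · rfl
        · exact ⟨c, hc, hyc⟩
        · refine hmono _ y ?_ (Finset.mem_filter.1 hc).2
          rintro _ rfl
          exact hyc
      · rw [Set.indicator_of_notMem fun h => hy (hex y h).2, Set.indicator_of_notMem]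
        exact hy
    simp only [h1]
    rw [lintegral_indicator_one MeasurableSet.of_discrete,
      lintegral_indicator_one MeasurableSet.of_discrete]
    rcases D.eq_empty_or_nonempty with h | ⟨c, hc⟩
    · simp [h]
    · have he := (hex _ (Finset.mem_filter.1 hc).2).1
      rw [exclColours_apply p α he]
      refine (indepColours_apply_le q D).trans ?_
      rw [Finset.mul_sum, ← nsmul_eq_mul, ← Finset.sum_const]
      exact Finset.sum_le_sum fun c _ => hq c

lemma indep_real_hitEvent [Fintype E] [DecidableEq E] [Fintype C] [DecidableEq C] {Ω : Type*}
    (q : I) (G : Finset Ω) (A : Ω → Finset (E × C)) :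
    (Measure.pi fun _ : E => indepColours C q).real (hitEvent G A) =
      1 - binExp Finset.univ (q : ℝ) (missInd G A) := by
  classical
  set μ := Measure.pi fun _ : E => indepColours C q
  have h1 : μ.real (hitEvent G A) = ∑ g, if g ∈ hitEvent G A then μ.real {g} else 0 := by
    rw [← Finset.sum_filter, sum_measureReal_singleton]
    congr 1
    ext g
    simp
  have h0 : 1 - binExp Finset.univ (q : ℝ) (missInd G A) =
      binExp Finset.univ (q : ℝ) (fun W => 1 - missInd G A W) := by
    rw [binExp_sub _ _ fun _ => 1, binExp_const]
  rw [h1, h0, binExp, Finset.powerset_univ]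
  symm
  refine Fintype.sum_bijective (fun (W : Finset (E × C)) e c => (e, c) ∈ W) ⟨?_, ?_⟩ _ _
    fun W => ?_
  · intro W W' h
    ext ⟨e, c⟩
    exact iff_of_eq (congrFun (congrFun h e) c)
  · intro g
    refine ⟨Finset.univ.filter fun x => g x.1 x.2, ?_⟩
    funext e c
    simp
  · have h2 : μ.real {fun e c => (e, c) ∈ W} =
        (q : ℝ) ^ W.card * (1 - q) ^ ((Finset.univ : Finset (E × C)).card - W.card) := by
      have h3 : μ.real {fun e c => (e, c) ∈ W} =
          ∏ e, ∏ c, (bernProp q).real {(e, c) ∈ W} := by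
        simp only [μ, indepColours, measureReal_def, Measure.pi_singleton, ENNReal.toReal_prod]
      rw [h3, ← Fintype.prod_prod_type' fun e c => (bernProp q).real {(e, c) ∈ W}]
      simp only [bernProp_real_singleton]
      have h5 : (Finset.univ.filter fun x : E × C => (x.1, x.2) ∉ W) = Wᶜ := by
        ext x
        simp
      rw [Finset.prod_ite, Finset.prod_const, Finset.prod_const, Finset.filter_univ_mem, h5,
        Finset.card_compl, Finset.card_univ]
    have h4 : (fun e c => (e, c) ∈ W) ∈ hitEvent G A ↔ ∃ ω ∈ G, A ω ⊆ W := Iff.rfl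
    rw [h2]
    simp only [h4, missInd]
    split_ifs <;> simp

end Coupling

/-! ### Choice of parameters and conclusion -/

section Final

lemma clog_two_le_three_mul_log {n : ℕ} (hn : 3 ≤ n) :
    (Nat.clog 2 n : ℝ) ≤ 3 * Real.log n := by
  have hn1 : (1 : ℝ) ≤ Real.log n := by
    rw [Real.le_log_iff_exp_le (by positivity)]
    calc Real.exp 1 ≤ 3 := Real.exp_one_lt_three.le
      _ ≤ n := by exact_mod_cast hn
  have h1 : 2 ^ (Nat.clog 2 n - 1) < n := Nat.pow_pred_clog_lt_self (by norm_num) (by omega)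
  have h2 : ((Nat.clog 2 n - 1 : ℕ) : ℝ) * Real.log 2 ≤ Real.log n := by
    rw [← Real.log_pow]
    refine Real.log_le_log (by positivity) ?_
    exact_mod_cast h1.le
  have h3 : (Nat.clog 2 n : ℝ) ≤ ((Nat.clog 2 n - 1 : ℕ) : ℝ) + 1 := by
    exact_mod_cast (by omega : Nat.clog 2 n ≤ Nat.clog 2 n - 1 + 1)
  have h4 : (0.5 : ℝ) ≤ Real.log 2 := by linarith [Real.log_two_gt_d9]
  have h5 : (0 : ℝ) ≤ ((Nat.clog 2 n - 1 : ℕ) : ℝ) := Nat.cast_nonneg _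
  nlinarith

/-- A `q`-spread family of `n`-sets of total weight one is missed with small probability by the
binomial random set with probability a constant times `q log n`. -/
lemma binExp_missInd_le {Ω X : Type*} [Fintype X] [DecidableEq X] {w : Ω → ℝ} (hw : ∀ ω, 0 ≤ w ω)
    {q p : ℝ} (hq : 0 < q) {n M : ℕ} (hn : 3 ≤ n) (hM : 1 ≤ M) {G : Finset Ω} {A : Ω → Finset X}
    (hs : IsSpread w q G A) (hA : ∀ ω ∈ G, (A ω).card ≤ n) (hG : ∑ ω ∈ G, w ω = 1)
    (hp : 25 * Real.log n * q ≤ p) (hp1 : p ≤ 1) :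
    binExp Finset.univ p (missInd G A) ≤ 2 ^ M / Real.log n + 2 * (1 / 2) ^ M := by
  have hn1 : (1 : ℝ) ≤ Real.log n := by
    rw [Real.le_log_iff_exp_le (by positivity)]
    calc Real.exp 1 ≤ 3 := Real.exp_one_lt_three.le
      _ ≤ n := by exact_mod_cast hn
  -- `B = log n` for the last round and `8 * clog 2 n ≤ 24 * log n` for the halvings give the
  -- constant `25`.
  have hpp : (Real.log n + 8 * Nat.clog 2 n) * q ≤ p := by
    refine le_trans ?_ hp
    gcongr
    linarith [clog_two_le_three_mul_log hn]
  have h := MissBound.rounds (X := X) hw hq hn1 hM (Nat.clog 2 n) (hpp.trans hp1)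
  have h0 : 0 ≤ (Real.log n + 8 * (Nat.clog 2 n : ℝ)) * q := by positivity
  have hl : n ≤ 2 ^ Nat.clog 2 n * M :=
    (Nat.le_pow_clog (by norm_num) n).trans (Nat.le_mul_of_pos_right _ hM)
  have h2 := (h.mono hl h0 hpp hp1 le_rfl) G A hs hA
  rw [hG] at h2
  have h3 : (0 : ℝ) ≤ 2 * (1 / 2) ^ M * (1 / 2) ^ Nat.clog 2 n := by positivity
  linarith

end Final

theorem theorem3 (k ℓ : ℕ) (α : PMF (Fin k)) (hα : ∀ i, 0 < α i) (δ : ℝ) (hδ : 0 < δ) :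
    ∃ K₀ : ℝ, ∀ K : ℝ, K₀ ≤ K → ∀ ε : ℝ, 0 < ε → ∃ n₀ : ℕ, ∀ n : ℕ, n₀ ≤ n →
      ∀ p : unitInterval, (p : ℝ) = K * Real.log n / n →
      ∀ β : Fin ℓ → ℝ, (∀ j, δ ≤ β j) →
      ∀ χ : Fin n → Fin ℓ,
        (∀ j, ((Finset.univ.filter fun v => χ v = j).card : ℝ) = β j * n) →
      ∀ c₁ : Fin n → Fin k, ∀ c₂ : Fin n → Fin ℓ,
        (∀ j, ((Finset.univ.filter fun i => c₂ i = j).card : ℝ) = β j * n) →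
      1 - ε ≤ (coloredRandomGraph n p α).real
        {X | HasPatternedHamiltonCycle X.1 X.2 χ c₁ c₂} := by
  have : Nonempty (Fin k) := ⟨α.support_nonempty.some⟩
  obtain ⟨i₀, hi₀⟩ := Finite.exists_min α
  set a : ℝ := (α i₀).toReal with ha
  have ha0 : 0 < a := ENNReal.toReal_pos (hα i₀).ne' (α.apply_ne_top i₀)
  have ha1 : a ≤ 1 := ENNReal.toReal_le_of_le_ofReal zero_le_one (by simpa using α.coe_le_one i₀)
  refine ⟨25 * (324 / δ ^ 2) / a, fun K hK ε hε => ?_⟩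
  -- The bound is applied with `M + 1`, which is positive: its second term is then `(1 / 2) ^ M < ε
  -- / 4`. With `M` fixed, the first term is at most `ε / 2` once `log n` is large, uniformly in the
  -- colourings and patterns.
  obtain ⟨M, hM⟩ : ∃ M : ℕ, ((1 : ℝ) / 2) ^ M < ε / 4 :=
    exists_pow_lt_of_lt_one (by positivity) (by norm_num)
  have hlog : ∀ᶠ n : ℕ in Filter.atTop, 2 ^ (M + 1) / (ε / 2) ≤ Real.log n :=
    (Real.tendsto_log_atTop.comp tendsto_natCast_atTop_atTop).eventually_ge_atTop _
  obtain ⟨n₁, hn₁⟩ := Filter.eventually_atTop.1 hlog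
  refine ⟨max n₁ 3, fun n hn p hp β hβ χ hχ c₁ c₂ hc₂ => ?_⟩
  have hn3 : 3 ≤ n := (le_max_right _ _).trans hn
  have : NeZero n := ⟨by omega⟩
  have hn0 : (0 : ℝ) < n := by exact_mod_cast (by omega : 0 < n)
  have hlogn := hn₁ n ((le_max_left _ _).trans hn)
  have hlog0 : 0 < Real.log n := lt_of_lt_of_le (by positivity) hlogn
  have hδ1 : δ ≤ 1 := by
    have h1 : β (χ 0) * n ≤ n := by
      rw [← hχ]
      exact_mod_cast (Finset.card_filter_le _ _).trans (by simp)
    have h2 := hβ (χ 0)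
    by_contra! h
    nlinarith
  have hcls : ∀ j, δ * n ≤ ((Finset.univ.filter fun v => χ v = j).card : ℝ) := fun j => by
    rw [hχ]
    exact mul_le_mul_of_nonneg_right (hβ j) hn0.le
  have hne := patternPerms_nonempty χ c₂ fun j => by
    exact_mod_cast (hχ j).trans (hc₂ j).symm
  have hpos : (0 : ℝ) < (patternPerms χ c₂).card := by exact_mod_cast hne.card_pos
  -- The probability that an edge is present with the rarest colour, hence a lower bound for every
  -- colour.
  let q : unitInterval := ⟨p * a, mul_nonneg p.2.1 ha0.le, mul_le_one₀ p.2.2 ha0.le ha1⟩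
  have hq : ∀ c, ENNReal.ofReal q ≤ ENNReal.ofReal p * α c := fun c => by
    rw [show (q : ℝ) = p * a from rfl, ENNReal.ofReal_mul p.2.1, ha,
      ENNReal.ofReal_toReal (α.apply_ne_top i₀)]
    gcongr
    exact hi₀ c
  have hmiss : binExp Finset.univ (q : ℝ) (missInd (patternPerms χ c₂) (colouredCycle c₁)) ≤ ε := by
    have hqp : 25 * Real.log n * (324 / δ ^ 2 / n) ≤ q := by
      rw [show (q : ℝ) = p * a from rfl, hp]
      rw [div_le_iff₀ ha0] at hK
      calc _ = 25 * (324 / δ ^ 2) * (Real.log n / n) := by ring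
        _ ≤ K * a * (Real.log n / n) := by gcongr
        _ = _ := by ring
    refine (binExp_missInd_le (fun _ => by positivity) (by positivity) hn3 (Nat.le_add_left 1 M)
      (isSpread_colouredCycle hn3 c₁ χ c₂ hδ hδ1 hcls hne)
      (fun σ _ => card_colouredCycle_le c₁ σ) ?_ hqp q.2.2).trans ?_
    · rw [Finset.sum_const, nsmul_eq_mul, mul_inv_cancel₀ hpos.ne']
    · have h1 : 2 ^ (M + 1) / Real.log n ≤ ε / 2 := by
        rw [div_le_iff₀ (by positivity)] at hlogn
        rw [div_le_iff₀ hlog0]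
        linarith
      have h2 : (0 : ℝ) < (1 / 2) ^ M := by positivity
      rw [pow_succ (1 / 2 : ℝ)]
      linarith
  have hsub : (fun X : SimpleGraph (Fin n) × (Sym2 (Fin n) → Fin k) =>
      fun (e : Sym2 (Fin n)) (c : Fin k) => e ∈ X.1.edgeSet ∧ X.2 e = c) ⁻¹'
        hitEvent (patternPerms χ c₂) (colouredCycle c₁) ⊆
      {X | HasPatternedHamiltonCycle X.1 X.2 χ c₁ c₂} := by
    rintro X ⟨σ, hσ, h⟩
    have h1 : ∀ i, s(σ i, σ (i + 1)) ∈ X.1.edgeSet ∧ X.2 s(σ i, σ (i + 1)) = c₁ i := fun i =>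
      h (s(σ i, σ (i + 1)), c₁ i) (Finset.mem_image_of_mem _ (Finset.mem_univ i))
    exact hasPatternedHamiltonCycle_of_perm hn3 σ (fun i => (h1 i).1) (fun i => (h1 i).2)
      (Finset.mem_filter.1 hσ).2
  have hle := indep_hitEvent_le p q α hq (patternPerms χ c₂) (colouredCycle c₁)
    (fun σ _ => colouredCycle_fst_injOn hn3 c₁ σ) fun σ _ x hx => by
      obtain ⟨i, _, rfl⟩ := Finset.mem_image.1 hx
      rw [Sym2.mk_isDiag_iff, EmbeddingLike.apply_eq_iff_eq]
      intro h
      have h1 : (1 : Fin n) = 0 := by simpa using h.symm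
      exact fin_one_add_one_ne_zero hn3 (by rw [h1, add_zero])
  have hprob : IsProbabilityMeasure (coloredRandomGraph n p α) := by
    unfold coloredRandomGraph
    infer_instance
  calc 1 - ε ≤ (Measure.pi fun _ : Sym2 (Fin n) => indepColours (Fin k) q).real
        (hitEvent (patternPerms χ c₂) (colouredCycle c₁)) := by
        rw [indep_real_hitEvent]
        linarith
    _ ≤ (Measure.pi fun e : Sym2 (Fin n) => exclColours p α e).real
        (hitEvent (patternPerms χ c₂) (colouredCycle c₁)) :=
        ENNReal.toReal_mono (measure_ne_top _ _) hle
    _ = (coloredRandomGraph n p α).real _ := by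
        rw [← map_coloredRandomGraph, map_measureReal_apply (measurable_colourSets n k)
          MeasurableSet.of_discrete]
    _ ≤ _ := measureReal_mono hsub
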